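/- There is an absolute constant $C>0$ such that the following holds for every finite field $\mathbb{F}_q$ ($q$ a prime power) and every subset $A\subset \mathbb{F}_q$. Write $A+A=\{x+y : x,y\in A\}$, $A^2=\{x^2 : x\in A\}$ and $A^2+A^2=\{x^2+y^2 : x,y\in A\}$. Suppose that $$|(A+A)\cap (aG+b)|\le |G|^{1/2}$$ for every subfield $G$ of $\mathbb{F}_q$ (including the prime field and $\mathbb{F}_q$ itself), every $a\in\mathbb{F}_q^*$ and every $b\in\mathbb{F}_q$, where $aG+b=\{ag+b : g\in G\}$. Then $$\max\{|A+A|,\ |A^2+A^2|\}\ \ge\ C\,|A|^{1+\frac{1}{42}}.$$ -/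

import Mathlib

open scoped Pointwise

/-- The set of squares `{x ^ 2 : x ∈ A}`. (This is not the product set `A * A`, which is what the
pointwise power would be.) -/
def squareSet {F : Type*} [Monoid F] [DecidableEq F] (A : Finset F) : Finset F :=
  A.image fun x => x ^ 2

/-!
Write `n = |A|` and let `K n` be the larger of `|A + A|` and `|A² + A²|`. The proof gives
`n ≤ 2 ^ 15 * K ^ 36`, which is stronger than what is needed.

**From squares to dilates.** By Cauchy–Schwarz the equation `a² + b² = c² + e²` has at least
`n³ / K` solutions in `A`. With `x = a + c` and `x' = b + e` it reads `x a = x' e + (x² - x'²) / 2`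
(in characteristic `≠ 2`), so `x • A` meets a fixed translate of `x' • A` once for every solution
with these sums. Fixing a popular `x' = x₀` yields a large set `X ⊆ A + A` such that for each `x ∈ X`
some translate of `x₀ • A` meets `x • A` in at least `n / (4 K³)` points
(`exists_popular_dilates`).

**Growth.** Let `R` be the set of ratios `(p - q) / (t - s)` with entries in `X`
(`ratioSet`). If `c ∉ R`, all sums `y + c z` with `y, z ∈ X` are distinct. Either `R` fails
to be closed under `r ↦ 1 + r` or under `r ↦ (x / x₀) r` for some `x ∈ X`, which provides such a `c`,
or `R` is a subfield `G` and `X ⊆ x₀ • G`. In the latter case the hypothesis on `A + A` gives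
`|X|² ≤ |G|`, and an average over `c ∈ G` produces `c ∈ R` with `|X + c • X| ≥ |X|² / 2`
(`exists_ratio_sq_card_le`).

**No growth.** On the other hand, Ruzsa's triangle inequality allows a summand `x • W` with `x ∈ X`
to be replaced by `x₀ • A`, at the cost of a factor `|W - A| / (n / (4 K³))`
(`card_smul_add_mul_le`). Clearing denominators turns each of the above `X + c • X` into a sum of
dilates by elements of `X`, which is thereby compared with `x₀ • (A + A + A + A)`; the remaining
sumsets of `A` are bounded by the Plünnecke–Ruzsa inequality. Comparing with the growth bounds `n`
(`card_le_mul_pow_of_popular_dilates`).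

In characteristic two the hypothesis for translates of the prime field forces `|A + A| ≤ 1`.
-/

/-! ### Cauchy–Schwarz for collisions of a map -/

/-- Cauchy–Schwarz: a map with a small image has many pairs of points with the same value. -/
theorem Finset.sq_card_le_card_image_mul_card_collisions {α β : Type*} [DecidableEq β]
    (s : Finset α) (f : α → β) :
    s.card ^ 2 ≤ (s.image f).card * ((s ×ˢ s).filter fun p => f p.1 = f p.2).card := by
  classical
  have h1 : s.card = ∑ b ∈ s.image f, (s.filter fun a => f a = b).card :=
    Finset.card_eq_sum_card_image f s
  have h2 : ((s ×ˢ s).filter fun p => f p.1 = f p.2).card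
      = ∑ b ∈ s.image f, (s.filter fun a => f a = b).card ^ 2 := by
    rw [Finset.card_eq_sum_card_fiberwise (f := fun p => f p.1) (t := s.image f)]
    · refine Finset.sum_congr rfl fun b _ => ?_
      rw [sq, ← Finset.card_product]
      congr 1
      ext ⟨x, y⟩
      simp only [Finset.mem_filter, Finset.mem_product]
      constructor
      · rintro ⟨⟨⟨hx, hy⟩, h⟩, rfl⟩
        exact ⟨⟨hx, rfl⟩, hy, h.symm⟩
      · rintro ⟨⟨hx, rfl⟩, hy, h⟩
        exact ⟨⟨⟨hx, hy⟩, h.symm⟩, rfl⟩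
    · intro p hp
      simp only [Finset.coe_filter, Finset.mem_product, Set.mem_ofPred_eq] at hp
      exact Finset.mem_coe.2 (Finset.mem_image_of_mem f hp.1.1)
  rw [h2]
  nth_rw 1 [h1]
  exact sq_sum_le_card_mul_sum_sq

/-! ### The set of ratios of differences -/

/-- The set of ratios `(p - q) / (t - s)` of differences of elements of `X`, with nonzero
denominator. It is empty when `X` has at most one element. -/
def ratioSet {F : Type*} [Field F] (X : Finset F) : Set F :=
  {r | ∃ p ∈ X, ∃ q ∈ X, ∃ t ∈ X, ∃ s ∈ X, t ≠ s ∧ r = (p - q) / (t - s)}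

section

variable {F : Type*} [Field F]

theorem zero_mem_ratioSet {X : Finset F} (hX : 2 ≤ X.card) : (0 : F) ∈ ratioSet X := by
  obtain ⟨t, ht, s, hs, hts⟩ := Finset.one_lt_card.1 hX
  exact ⟨t, ht, t, ht, t, ht, s, hs, hts, by simp⟩

theorem one_mem_ratioSet {X : Finset F} (hX : 2 ≤ X.card) : (1 : F) ∈ ratioSet X := by
  obtain ⟨t, ht, s, hs, hts⟩ := Finset.one_lt_card.1 hX
  exact ⟨t, ht, s, hs, t, ht, s, hs, hts, (div_self (sub_ne_zero.2 hts)).symm⟩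

theorem neg_mem_ratioSet {X : Finset F} {r : F} (hr : r ∈ ratioSet X) : -r ∈ ratioSet X := by
  obtain ⟨p, hp, q, hq, t, ht, s, hs, hts, rfl⟩ := hr
  exact ⟨q, hq, p, hp, t, ht, s, hs, hts, by rw [← neg_div, neg_sub]⟩

variable [DecidableEq F]

theorem card_add_smul_of_notMem_ratioSet {X : Finset F} {c : F} (hc : c ∉ ratioSet X) :
    (X + c • X).card = X.card ^ 2 := by
  have : X + c • X = (X ×ˢ X).image fun p => p.1 + c * p.2 := by
    ext z
    simp only [Finset.mem_add, Finset.mem_smul_finset, Finset.mem_image, Finset.mem_product,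
      Prod.exists, smul_eq_mul]
    constructor
    · rintro ⟨y, hy, _, ⟨w, hw, rfl⟩, rfl⟩
      exact ⟨y, w, ⟨hy, hw⟩, rfl⟩
    · rintro ⟨y, w, ⟨hy, hw⟩, rfl⟩
      exact ⟨y, hy, _, ⟨w, hw, rfl⟩, rfl⟩
  rw [this, Finset.card_image_of_injOn, Finset.card_product, sq]
  rintro ⟨y, w⟩ h ⟨y', w'⟩ h' heq
  simp only [Finset.coe_product, Set.mem_prod, Finset.mem_coe] at h h'
  simp only at heq
  have hw : w' = w := by
    by_contra hne
    refine hc ⟨y, h.1, y', h'.1, w', h'.2, w, h.2, hne, ?_⟩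
    rw [eq_div_iff (sub_ne_zero.2 hne)]
    linear_combination -heq
  subst hw
  simpa using heq

/-- If the ratio set is closed under `r ↦ 1 + r` and under multiplication by `X / x₀`, then it is the
subfield generated by `X / x₀`. Indeed let `h ≠ 0` be a product of elements of `X / x₀`. Then
`h + r = h * (1 + h⁻¹ * r)` shows that the ratio set is stable under addition of `h`, hence under
addition of every element of the subring generated by `X / x₀`, which is a field by finiteness. -/
theorem exists_subfield_eq_ratioSet [Finite F] {X : Finset F} (hX : 2 ≤ X.card) {x₀ : F}
    (hx₀ : x₀ ≠ 0) (h_one : ∀ r ∈ ratioSet X, 1 + r ∈ ratioSet X)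
    (h_mul : ∀ x ∈ X, ∀ r ∈ ratioSet X, x / x₀ * r ∈ ratioSet X) :
    ∃ G : Subfield F, (G : Set F) = ratioSet X ∧ (X : Set F) ⊆ x₀ • (G : Set F) := by
  set Y : Set F := (fun x => x / x₀) '' (X : Set F)
  -- `T` and `M` are the additive and the multiplicative stabilizer of the ratio set.
  let T : AddSubgroup F :=
    { carrier := {h | ∀ r ∈ ratioSet X, h + r ∈ ratioSet X}
      zero_mem' := by simp
      add_mem' := fun {a b} ha hb r hr => by rw [add_assoc]; exact ha _ (hb r hr)
      neg_mem' := fun {a} ha r hr => by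
        have := neg_mem_ratioSet (ha _ (neg_mem_ratioSet hr))
        rwa [neg_add, neg_neg] at this }
  let M : Submonoid F :=
    { carrier := {h | ∀ r ∈ ratioSet X, h * r ∈ ratioSet X}
      one_mem' := by simp
      mul_mem' := fun {a b} ha hb r hr => by rw [mul_assoc]; exact ha _ (hb r hr) }
  have inv_eq_pow (h : F) (hh : h ≠ 0) : ∃ k : ℕ, h⁻¹ = h ^ k := by
    cases nonempty_fintype F
    refine ⟨Fintype.card F - 2, ?_⟩
    have h2 : Fintype.card F - 2 + 1 = Fintype.card F - 1 := by
      have := Fintype.one_lt_card (α := F)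
      omega
    rw [inv_eq_iff_eq_inv, ← mul_eq_one_iff_eq_inv₀ (pow_ne_zero _ hh), ← pow_succ', h2]
    exact FiniteField.pow_card_sub_one_eq_one h hh
  have hMT (h : F) (hM : h ∈ M) : h ∈ T := by
    intro r hr
    by_cases hh : h = 0
    · simpa [hh] using hr
    have hinv : h⁻¹ ∈ M := by
      obtain ⟨k, hk⟩ := inv_eq_pow h hh
      rw [hk]
      exact pow_mem hM k
    have := hM _ (h_one _ (hinv r hr))
    rwa [mul_add, mul_one, mul_inv_cancel_left₀ hh] at this
  have hYM : Submonoid.closure Y ≤ M := by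
    rw [Submonoid.closure_le]
    rintro _ ⟨x, hx, rfl⟩
    exact h_mul x hx
  have hclT : ∀ g ∈ Subring.closure Y, g ∈ ratioSet X := by
    intro g hg
    rw [Subring.mem_closure_iff] at hg
    have : AddSubgroup.closure (Submonoid.closure Y : Set F) ≤ T :=
      (AddSubgroup.closure_le _).2 fun h hh => hMT h (hYM hh)
    simpa using this hg 0 (zero_mem_ratioSet hX)
  let G : Subfield F :=
    { Subring.closure Y with
      inv_mem' := fun g hg => by
        by_cases hg0 : g = 0
        · simp [hg0]
        obtain ⟨k, hk⟩ := inv_eq_pow g hg0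
        rw [hk]
        exact (Subring.closure Y).pow_mem hg k }
  have hXG (x : F) (hx : x ∈ X) : x / x₀ ∈ G := Subring.subset_closure ⟨x, hx, rfl⟩
  refine ⟨G, Set.Subset.antisymm hclT ?_, fun x hx => ?_⟩
  · rintro _ ⟨p, hp, q, hq, t, ht, s, hs, -, rfl⟩
    rw [← div_div_div_cancel_right₀ hx₀, sub_div p, sub_div t]
    exact div_mem (sub_mem (hXG p hp) (hXG q hq)) (sub_mem (hXG t ht) (hXG s hs))
  · exact ⟨x / x₀, hXG x hx, by simp [mul_div_cancel₀ _ hx₀]⟩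

/-- On average over `c ∈ G`, the equation `y + c * z = y' + c * z'` has at most `2 * |X| ^ 2` solutions
in `X`: a quadruple with `(y, z) ≠ (y', z')` solves it for at most one `c`. -/
theorem exists_mem_subfield_sq_card_le [Finite F] (G : Subfield F) {X : Finset F}
    (hX : X.card ^ 2 ≤ Nat.card G) :
    ∃ c ∈ G, X.card ^ 2 ≤ 2 * (X + c • X).card := by
  classical
  cases nonempty_fintype F
  obtain rfl | hne := X.eq_empty_or_nonempty
  · exact ⟨0, G.zero_mem, by simp⟩
  let Q : F → Finset ((F × F) × (F × F)) := fun c =>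
    ((X ×ˢ X) ×ˢ (X ×ˢ X)).filter fun p => p.1.1 + c * p.1.2 = p.2.1 + c * p.2.2
  let g : Finset F := Finset.univ.filter (· ∈ G)
  have hg : g.card = Nat.card G := by
    rw [Nat.card_eq_fintype_card, Fintype.card_subtype]
  have hgpos : 0 < g.card := by rw [hg]; exact Nat.card_pos
  have hsum : ∑ c ∈ g, (Q c).card ≤ g.card * (2 * X.card ^ 2) := by
    have hswap : ∑ c ∈ g, (Q c).card = ∑ p ∈ (X ×ˢ X) ×ˢ (X ×ˢ X),
        (g.filter fun c => p.1.1 + c * p.1.2 = p.2.1 + c * p.2.2).card := by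
      simp only [Q, Finset.card_filter]
      exact Finset.sum_comm
    have hterm : ∀ p ∈ (X ×ˢ X) ×ˢ (X ×ˢ X),
        (g.filter fun c => p.1.1 + c * p.1.2 = p.2.1 + c * p.2.2).card
          ≤ (if p.1 = p.2 then g.card else 0) + 1 := by
      rintro ⟨⟨y, z⟩, ⟨y', z'⟩⟩ -
      simp only
      split_ifs with h
      · exact (Finset.card_filter_le _ _).trans (Nat.le_succ _)
      · rw [zero_add, Finset.card_le_one]
        intro a ha b hb
        simp only [Finset.mem_filter] at ha hb
        have hz : z - z' ≠ 0 := by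
          intro hz
          have hz := sub_eq_zero.1 hz
          subst hz
          exact h (by simpa using ha.2)
        have : (a - b) * (z - z') = 0 := by linear_combination ha.2 - hb.2
        exact sub_eq_zero.1 ((mul_eq_zero.1 this).resolve_right hz)
    have hdiag : (((X ×ˢ X) ×ˢ (X ×ˢ X)).filter fun p => p.1 = p.2).card = X.card ^ 2 := by
      have : (((X ×ˢ X) ×ˢ (X ×ˢ X)).filter fun p => p.1 = p.2) = (X ×ˢ X).diag := by
        ext p
        simp only [Finset.mem_filter, Finset.mem_product, Finset.mem_diag]
        constructor
        · exact fun h => ⟨h.1.1, h.2⟩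
        · exact fun h => ⟨⟨h.1, h.2 ▸ h.1⟩, h.2⟩
      rw [this, Finset.diag_card, Finset.card_product, sq]
    calc ∑ c ∈ g, (Q c).card
        ≤ ∑ p ∈ (X ×ˢ X) ×ˢ (X ×ˢ X), ((if p.1 = p.2 then g.card else 0) + 1) := by
          rw [hswap]; exact Finset.sum_le_sum hterm
      _ = X.card ^ 2 * g.card + X.card ^ 2 * X.card ^ 2 := by
          rw [Finset.sum_add_distrib, ← Finset.sum_filter, Finset.sum_const, hdiag,
            Finset.sum_const, Finset.card_product, Finset.card_product]
          simp only [smul_eq_mul, mul_one]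
          ring
      _ ≤ X.card ^ 2 * g.card + X.card ^ 2 * g.card := by
          gcongr
          rwa [hg]
      _ = g.card * (2 * X.card ^ 2) := by ring
  obtain ⟨c, hc, hQ⟩ : ∃ c ∈ g, (Q c).card ≤ 2 * X.card ^ 2 := by
    by_contra! hcon
    have := Finset.sum_lt_sum_of_nonempty (Finset.card_pos.1 hgpos) hcon
    rw [Finset.sum_const, smul_eq_mul] at this
    omega
  refine ⟨c, (Finset.mem_filter.1 hc).2, ?_⟩
  have hcs := (X ×ˢ X).sq_card_le_card_image_mul_card_collisions fun p => p.1 + c * p.2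
  have himg : (X ×ˢ X).image (fun p => p.1 + c * p.2) ⊆ X + c • X := by
    intro z hz
    obtain ⟨⟨y, w⟩, hyw, rfl⟩ := Finset.mem_image.1 hz
    rw [Finset.mem_product] at hyw
    exact Finset.add_mem_add hyw.1 (Finset.smul_mem_smul_finset hyw.2)
  have hpos : 0 < X.card ^ 2 := pow_pos hne.card_pos 2
  refine Nat.le_of_mul_le_mul_left ?_ hpos
  calc X.card ^ 2 * X.card ^ 2 = (X ×ˢ X).card ^ 2 := by rw [Finset.card_product]; ring
    _ ≤ _ := hcs
    _ ≤ (X + c • X).card * (2 * X.card ^ 2) := Nat.mul_le_mul (Finset.card_le_card himg) hQ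
    _ = X.card ^ 2 * (2 * (X + c • X).card) := by ring

/-- There is a multiplier `c`, simply expressed through a ratio `r`, for which `X + c • X` has nearly
the largest possible size. The hypothesis on subfields is the only barrier. -/
theorem exists_ratio_sq_card_le [Finite F] {X : Finset F} (hX : 2 ≤ X.card) {x₀ : F}
    (hx₀ : x₀ ≠ 0)
    (hG : ∀ G : Subfield F, (X : Set F) ⊆ x₀ • (G : Set F) → X.card ^ 2 ≤ Nat.card G) :
    ∃ r ∈ ratioSet X, ∃ c : F, (c = r ∨ c = 1 + r ∨ r ≠ 0 ∧ ∃ x ∈ X, c = x / x₀ * r) ∧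
      X.card ^ 2 ≤ 2 * (X + c • X).card := by
  by_cases h_one : ∀ r ∈ ratioSet X, 1 + r ∈ ratioSet X
  · by_cases h_mul : ∀ x ∈ X, ∀ r ∈ ratioSet X, x / x₀ * r ∈ ratioSet X
    · obtain ⟨G, hGR, hXG⟩ := exists_subfield_eq_ratioSet hX hx₀ h_one h_mul
      obtain ⟨c, hc, hcard⟩ := exists_mem_subfield_sq_card_le G (hG G hXG)
      exact ⟨c, hGR ▸ hc, c, Or.inl rfl, hcard⟩
    · push Not at h_mul
      obtain ⟨x, hx, r, hr, hxr⟩ := h_mul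
      refine ⟨r, hr, _, Or.inr (Or.inr ⟨?_, x, hx, rfl⟩), ?_⟩
      · rintro rfl
        exact hxr (by simpa using hr)
      · rw [card_add_smul_of_notMem_ratioSet hxr]
        omega
  · push Not at h_one
    obtain ⟨r, hr, h⟩ := h_one
    refine ⟨r, hr, _, Or.inr (Or.inl rfl), ?_⟩
    rw [card_add_smul_of_notMem_ratioSet h]
    omega

end

/-! ### Sumsets of dilates -/

section

variable {F : Type*} [Field F] [DecidableEq F]

theorem Finset.card_smul_of_ne_zero {c : F} (hc : c ≠ 0) (V : Finset F) :
    (c • V).card = V.card :=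
  Finset.card_image_of_injective _ (mul_right_injective₀ hc)

/-- If `x • A` and a translate of `x₀ • A` have at least `N` common points, then in a sumset
`x • W + U` the summand `x • W` may be replaced by `x₀ • A` at the cost of a factor
`|W - A| / N`. -/
theorem card_smul_add_mul_le {A : Finset F} {x x₀ t : F} {N : ℝ}
    (hN : N ≤ ((x • A ∩ (x₀ • A + {t})).card : ℝ)) (W U : Finset F) :
    ((x • W + U).card : ℝ) * N ≤ (W - A).card * (x₀ • A + U).card := by
  set B := x • A ∩ (x₀ • A + {t})
  have h1 : (B - x • W).card ≤ (W - A).card :=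
    calc (B - x • W).card ≤ (x • A - x • W).card :=
          Finset.card_le_card (Finset.sub_subset_sub_right Finset.inter_subset_left)
      _ ≤ (A - W).card := by
          refine (Finset.card_le_card ?_).trans (Finset.card_image_le (s := A - W) (f := (x • ·)))
          intro z hz
          obtain ⟨_, ha, _, hw, rfl⟩ := Finset.mem_sub.1 hz
          obtain ⟨a, ha', rfl⟩ := Finset.mem_smul_finset.1 ha
          obtain ⟨w, hw', rfl⟩ := Finset.mem_smul_finset.1 hw
          exact Finset.mem_image.2 ⟨a - w, Finset.sub_mem_sub ha' hw', smul_sub x a w⟩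
      _ = (W - A).card := by rw [← neg_sub, Finset.card_neg]
  have h2 : (B + U).card ≤ (x₀ • A + U).card :=
    calc (B + U).card ≤ (x₀ • A + {t} + U).card :=
          Finset.card_le_card (Finset.add_subset_add_right Finset.inter_subset_right)
      _ = (x₀ • A + U).card := by
          rw [add_right_comm, Finset.card_add_singleton]
  have h3 := Finset.ruzsa_triangle_inequality_add_sub_add (x • W) B U
  calc ((x • W + U).card : ℝ) * N ≤ (x • W + U).card * B.card := by gcongr
    _ ≤ (W - A).card * (x₀ • A + U).card := by
        rw [mul_comm]
        exact_mod_cast h3.trans (Nat.mul_le_mul h1 h2)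

/-- Clearing denominators, `Y + r • Z` with `r = (p - q) / (t - s)` embeds into
`t • Y - s • Y + p • Z - q • Z`, whose four dilates can all be replaced by `x₀ • A`. -/
theorem card_add_ratio_smul_le {A X : Finset F} {x₀ : F} {N : ℝ} (hN0 : 0 ≤ N)
    (hN : ∀ x ∈ X, ∃ t, N ≤ ((x • A ∩ (x₀ • A + {t})).card : ℝ)) {r : F} (hr : r ∈ ratioSet X)
    (Y Z : Finset F) :
    ((Y + r • Z).card : ℝ) * N ^ 4 ≤
      (Y - A).card * (Y + A).card * ((Z - A).card * (Z + A).card) * (A + A + A + A).card := by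
  obtain ⟨p, hp, q, hq, t, ht, s, hs, hts, rfl⟩ := hr
  have hts' : t - s ≠ 0 := sub_ne_zero.2 hts
  have hstart : (Y + ((p - q) / (t - s)) • Z).card ≤
      (t • Y + (s • (-Y) + (p • Z + q • (-Z)))).card := by
    rw [← Finset.card_smul_of_ne_zero hts']
    refine Finset.card_le_card ?_
    intro v hv
    obtain ⟨_, hw, rfl⟩ := Finset.mem_smul_finset.1 hv
    obtain ⟨y, hy, _, hz', rfl⟩ := Finset.mem_add.1 hw
    obtain ⟨z, hz, rfl⟩ := Finset.mem_smul_finset.1 hz'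
    have : (t - s) • (y + ((p - q) / (t - s)) • z)
        = t • y + (s • (-y) + (p • z + q • (-z))) := by
      simp only [smul_eq_mul]
      field_simp
      ring
    rw [this]
    exact Finset.add_mem_add (Finset.smul_mem_smul_finset hy) <| Finset.add_mem_add
      (Finset.smul_mem_smul_finset (Finset.neg_mem_neg hy)) <| Finset.add_mem_add
      (Finset.smul_mem_smul_finset hz) (Finset.smul_mem_smul_finset (Finset.neg_mem_neg hz))
  have hneg (V : Finset F) : (-V - A).card = (V + A).card := by
    rw [← Finset.card_neg, neg_sub, sub_neg_eq_add, add_comm]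
  obtain ⟨_, h1⟩ := hN t ht
  obtain ⟨_, h2⟩ := hN s hs
  obtain ⟨_, h3⟩ := hN p hp
  obtain ⟨_, h4⟩ := hN q hq
  have h1 := card_smul_add_mul_le h1 Y (s • (-Y) + (p • Z + q • (-Z)))
  have h2 := card_smul_add_mul_le h2 (-Y) (x₀ • A + (p • Z + q • (-Z)))
  have h3 := card_smul_add_mul_le h3 Z (x₀ • A + (x₀ • A + q • (-Z)))
  have h4 := card_smul_add_mul_le h4 (-Z) (x₀ • A + (x₀ • A + x₀ • A))
  rw [hneg] at h2 h4
  rw [show p • Z + (x₀ • A + (x₀ • A + q • (-Z))) = x₀ • A + (x₀ • A + (p • Z + q • (-Z))) by abel]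
    at h3
  rw [show q • (-Z) + (x₀ • A + (x₀ • A + x₀ • A)) = x₀ • A + (x₀ • A + (x₀ • A + q • (-Z))) by abel]
    at h4
  have h5 : (x₀ • A + (x₀ • A + (x₀ • A + x₀ • A))).card ≤ (A + A + A + A).card := by
    rw [← smul_add, ← smul_add, ← smul_add, ← add_assoc, ← add_assoc]
    exact Finset.card_image_le
  have h5 : ((x₀ • A + (x₀ • A + (x₀ • A + x₀ • A))).card : ℝ) ≤ (A + A + A + A).card := by
    exact_mod_cast h5
  calc ((Y + ((p - q) / (t - s)) • Z).card : ℝ) * N ^ 4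
      ≤ (t • Y + (s • (-Y) + (p • Z + q • (-Z)))).card * N ^ 4 := by gcongr
    _ = ((t • Y + (s • (-Y) + (p • Z + q • (-Z)))).card * N) * N ^ 3 := by ring
    _ ≤ ((Y - A).card * (x₀ • A + (s • (-Y) + (p • Z + q • (-Z)))).card) * N ^ 3 := by gcongr
    _ = (Y - A).card * ((x₀ • A + (s • (-Y) + (p • Z + q • (-Z)))).card * N) * N ^ 2 := by ring
    _ ≤ (Y - A).card *
        ((Y + A).card * (x₀ • A + (x₀ • A + (p • Z + q • (-Z)))).card) * N ^ 2 := by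
        rw [add_left_comm (x₀ • A)]
        gcongr
    _ = (Y - A).card * (Y + A).card *
        ((x₀ • A + (x₀ • A + (p • Z + q • (-Z)))).card * N) * N := by ring
    _ ≤ (Y - A).card * (Y + A).card *
        ((Z - A).card * (x₀ • A + (x₀ • A + (x₀ • A + q • (-Z)))).card) * N := by
        gcongr
    _ = (Y - A).card * (Y + A).card * (Z - A).card *
        ((x₀ • A + (x₀ • A + (x₀ • A + q • (-Z)))).card * N) := by ring
    _ ≤ (Y - A).card * (Y + A).card * (Z - A).card *
        ((Z + A).card * (x₀ • A + (x₀ • A + (x₀ • A + x₀ • A))).card) := by gcongr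
    _ ≤ (Y - A).card * (Y + A).card * (Z - A).card * ((Z + A).card * (A + A + A + A).card) := by
        gcongr
    _ = _ := by ring

/-- The Plünnecke–Ruzsa inequality for `k • A - l • A` (iterated sumsets), for real `K`. The set is
passed as `V` so that it can be written out as a sum of copies of `A`. -/
theorem card_nsmul_sub_nsmul_le {A : Finset F} (hA : A.Nonempty) {K : ℝ}
    (hK : ((A + A).card : ℝ) ≤ K * A.card) (k l : ℕ) {V : Finset F}
    (hV : V = k • A - l • A) : (V.card : ℝ) ≤ K ^ (k + l) * A.card := by
  have hApos : (0 : ℝ) < A.card := by exact_mod_cast hA.card_pos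
  have h := Finset.pluennecke_ruzsa_inequality_nsmul_sub_nsmul_add hA A k l
  have h' : (((k • A - l • A).card : ℕ) : ℝ) ≤
      (((A + A).card : ℝ) / A.card) ^ (k + l) * A.card := by
    have := (NNRat.cast_le (K := ℝ)).2 h
    push_cast at this
    exact this
  rw [hV]
  refine h'.trans ?_
  gcongr
  rwa [div_le_iff₀ hApos]

/-- The growth of `X + c • X` for a suitable `c`, compared with the upper bounds that follow from the
common points of the dilates of `A`, bounds `A` by a power of its doubling constant. -/
theorem card_le_mul_pow_of_popular_dilates [Finite F] {A X : Finset F} {x₀ : F} {K : ℝ}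
    (hA : A.Nonempty) (hK1 : 1 ≤ K) (hK : ((A + A).card : ℝ) ≤ K * A.card)
    (hx₀ : x₀ ≠ 0) (hXA : X ⊆ A + A) (hX2 : 2 ≤ X.card)
    (hXcard : (A.card : ℝ) / (4 * K ^ 2) ≤ X.card)
    (hN : ∀ x ∈ X, ∃ t, (A.card : ℝ) / (4 * K ^ 3) ≤ ((x • A ∩ (x₀ • A + {t})).card : ℝ))
    (hG : ∀ G : Subfield F, (X : Set F) ⊆ x₀ • (G : Set F) → X.card ^ 2 ≤ Nat.card G) :
    (A.card : ℝ) ≤ 2 ^ 15 * K ^ 36 := by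
  obtain ⟨r, hr, c, hc, hcard⟩ := exists_ratio_sq_card_le hX2 hx₀ hG
  have hK0 : 0 < K := by linarith
  set n : ℝ := (A.card : ℝ)
  have hn : 0 < n := Nat.cast_pos.2 hA.card_pos
  set N : ℝ := n / (4 * K ^ 3) with hNdef
  have hN0 : 0 < N := by positivity
  have hcard : (X.card : ℝ) ^ 2 ≤ 2 * (X + c • X).card := by exact_mod_cast hcard
  have hlow : n ^ 2 / (2 ^ 5 * K ^ 4) ≤ (X + c • X).card := by
    have : (n / (4 * K ^ 2)) ^ 2 ≤ (X.card : ℝ) ^ 2 := by gcongr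
    rw [div_pow] at this
    have h2 : n ^ 2 / (2 ^ 5 * K ^ 4) = n ^ 2 / (4 * K ^ 2) ^ 2 / 2 := by
      field_simp
      norm_num
    rw [h2]
    linarith
  have mono {V W : Finset F} {b : ℝ} (hVW : V ⊆ W) (hW : (W.card : ℝ) ≤ b) : (V.card : ℝ) ≤ b :=
    le_trans (by exact_mod_cast Finset.card_le_card hVW) hW
  have hAA : ((A - A).card : ℝ) ≤ K ^ 2 * n :=
    card_nsmul_sub_nsmul_le hA hK 1 1 (by simp)
  have h4A : ((A + A + A + A).card : ℝ) ≤ K ^ 4 * n :=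
    card_nsmul_sub_nsmul_le hA hK 4 0 (by simp [succ_nsmul])
  have hXs : ((X - A).card : ℝ) ≤ K ^ 3 * n :=
    mono (Finset.sub_subset_sub_right hXA)
      (card_nsmul_sub_nsmul_le hA hK 2 1 (by simp [succ_nsmul]))
  have hXp : ((X + A).card : ℝ) ≤ K ^ 3 * n :=
    mono (Finset.add_subset_add_right hXA)
      (card_nsmul_sub_nsmul_le hA hK 3 0 (by simp [succ_nsmul]))
  have hXXs : ((X + X - A).card : ℝ) ≤ K ^ 5 * n :=
    mono (Finset.sub_subset_sub_right (Finset.add_subset_add hXA hXA))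
      (card_nsmul_sub_nsmul_le hA hK 4 1 (by simp [succ_nsmul, add_assoc]))
  have hXXp : ((X + X + A).card : ℝ) ≤ K ^ 5 * n :=
    mono (Finset.add_subset_add_right (Finset.add_subset_add hXA hXA))
      (card_nsmul_sub_nsmul_le hA hK 5 0 (by simp [succ_nsmul, add_assoc]))
  have hpow {i : ℕ} (hi : i ≤ 36) {C : ℝ} (hC0 : 0 ≤ C) (hC : C ≤ 2 ^ 15) (h : n ≤ C * K ^ i) :
      n ≤ 2 ^ 15 * K ^ 36 :=
    h.trans (mul_le_mul hC (pow_le_pow_right₀ hK1 hi) (by positivity) (by positivity))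
  clear_value n
  -- `hpow` absorbs the three bounds `2 ^ 13 * K ^ 32`, `2 ^ 13 * K ^ 36` and `2 ^ 15 * K ^ 35`,
  -- one for each form of `c`.
  rcases hc with rfl | rfl | ⟨hr0, x, hx, rfl⟩
  · have hb := card_add_ratio_smul_le hN0.le hN hr X X
    have hb' : n ^ 2 / (2 ^ 5 * K ^ 4) * N ^ 4 ≤
        K ^ 3 * n * (K ^ 3 * n) * (K ^ 3 * n * (K ^ 3 * n)) * (K ^ 4 * n) :=
      le_trans (by gcongr) (hb.trans (by gcongr))
    refine hpow (i := 32) (C := 2 ^ 13) (by norm_num) (by norm_num) (by norm_num) ?_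
    rw [hNdef, div_pow, div_mul_div_comm, div_le_iff₀ (by positivity)] at hb'
    refine le_of_mul_le_mul_right (a := n ^ 5) ?_ (by positivity)
    linarith
  · have hb := card_add_ratio_smul_le hN0.le hN hr (X + X) X
    have hsub : X + (1 + r) • X ⊆ X + X + r • X := by
      rw [add_assoc]
      refine Finset.add_subset_add_left ?_
      intro z hz
      obtain ⟨w, hw, rfl⟩ := Finset.mem_smul_finset.1 hz
      rw [add_smul, one_smul]
      exact Finset.add_mem_add hw (Finset.smul_mem_smul_finset hw)
    have hlow := hlow.trans (mono hsub le_rfl)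
    have hb' : n ^ 2 / (2 ^ 5 * K ^ 4) * N ^ 4 ≤
        K ^ 5 * n * (K ^ 5 * n) * (K ^ 3 * n * (K ^ 3 * n)) * (K ^ 4 * n) :=
      le_trans (by gcongr) (hb.trans (by gcongr))
    refine hpow (i := 36) (C := 2 ^ 13) (by norm_num) (by norm_num) (by norm_num) ?_
    rw [hNdef, div_pow, div_mul_div_comm, div_le_iff₀ (by positivity)] at hb'
    refine le_of_mul_le_mul_right (a := n ^ 5) ?_ (by positivity)
    linarith
  · have hb := card_add_ratio_smul_le hN0.le hN hr X A
    obtain ⟨t, ht⟩ := hN x hx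
    have hs := card_smul_add_mul_le ht X ((x₀ / r) • X)
    have hu : x₀ / r ≠ 0 := div_ne_zero hx₀ hr0
    -- Multiplying by `x₀ / r` turns the dilate by `x / x₀ * r` into a dilate by `x`. Once that is
    -- replaced by `x₀ • A`, multiplying back leaves `X + r • A`.
    have e1 : (X + (x / x₀ * r) • X).card = (x • X + (x₀ / r) • X).card := by
      have h : x₀ / r * (x / x₀ * r) = x := by field_simp
      rw [← Finset.card_smul_of_ne_zero hu, smul_add, smul_smul, h, add_comm]
    have e2 : (x₀ • A + (x₀ / r) • X).card = (X + r • A).card := by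
      have h : x₀ / r * r = x₀ := by field_simp
      rw [← Finset.card_smul_of_ne_zero hu (X + r • A), smul_add, smul_smul, h, add_comm]
    rw [← e1, e2] at hs
    have hA1 : ((A + A).card : ℝ) ≤ K * n := hK
    have hb : ((X + r • A).card : ℝ) * N ^ 4 ≤
        K ^ 3 * n * (K ^ 3 * n) * (K ^ 2 * n * (K * n)) * (K ^ 4 * n) := by
      refine hb.trans ?_
      gcongr
    have hb' : n ^ 2 / (2 ^ 5 * K ^ 4) * N ^ 5 ≤
        (K ^ 3 * n) * (K ^ 3 * n * (K ^ 3 * n) * (K ^ 2 * n * (K * n)) * (K ^ 4 * n)) :=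
      calc n ^ 2 / (2 ^ 5 * K ^ 4) * N ^ 5 ≤ (X + (x / x₀ * r) • X).card * N ^ 5 := by gcongr
        _ = (X + (x / x₀ * r) • X).card * N * N ^ 4 := by ring
        _ ≤ (X - A).card * (X + r • A).card * N ^ 4 := by gcongr
        _ = (X - A).card * ((X + r • A).card * N ^ 4) := by ring
        _ ≤ _ := by gcongr
    refine hpow (i := 35) (C := 2 ^ 15) (by norm_num) (by norm_num) (by norm_num) ?_
    rw [hNdef, div_pow, div_mul_div_comm, div_le_iff₀ (by positivity)] at hb'
    refine le_of_mul_le_mul_right (a := n ^ 6) ?_ (by positivity)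
    linarith

end

/-! ### Popular dilates from sums of squares -/

/-- If `A + A` and `A² + A²` are small, then for some `x₀ ≠ 0` and many `x ∈ A + A` the dilate
`x • A` has many points in common with a translate of `x₀ • A`. -/
theorem exists_popular_dilates {F : Type*} [Field F] [DecidableEq F] (h2 : (2 : F) ≠ 0)
    {A : Finset F} {K : ℝ} (hA : A.Nonempty) (hK0 : 0 < K) (hKn : K ≤ A.card / 8)
    (hK : ((A + A).card : ℝ) ≤ K * A.card)
    (hsq : ((squareSet A + squareSet A).card : ℝ) ≤ K * A.card) :
    ∃ x₀ : F, x₀ ≠ 0 ∧ ∃ X ⊆ A + A, (A.card : ℝ) / (4 * K ^ 2) ≤ X.card ∧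
      ∀ x ∈ X, ∃ t, (A.card : ℝ) / (4 * K ^ 3) ≤ ((x • A ∩ (x₀ • A + {t})).card : ℝ) := by
  set n : ℝ := (A.card : ℝ) with hn_def
  have hn : 0 < n := Nat.cast_pos.2 hA.card_pos
  set S := (A + A).erase 0 with hS
  have hScard : (S.card : ℝ) ≤ K * n :=
    le_trans (by exact_mod_cast Finset.card_le_card (Finset.erase_subset 0 (A + A))) hK
  let Q : Finset ((F × F) × (F × F)) :=
    ((A ×ˢ A) ×ˢ (A ×ˢ A)).filter fun p => p.1.1 ^ 2 + p.1.2 ^ 2 = p.2.1 ^ 2 + p.2.2 ^ 2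
  have hQ : n ^ 3 ≤ K * Q.card := by
    have h := (A ×ˢ A).sq_card_le_card_image_mul_card_collisions fun p => p.1 ^ 2 + p.2 ^ 2
    have himg : (A ×ˢ A).image (fun p => p.1 ^ 2 + p.2 ^ 2) ⊆ squareSet A + squareSet A := by
      intro z hz
      obtain ⟨⟨a, b⟩, hab, rfl⟩ := Finset.mem_image.1 hz
      rw [Finset.mem_product] at hab
      exact Finset.add_mem_add (Finset.mem_image_of_mem _ hab.1) (Finset.mem_image_of_mem _ hab.2)
    have h' := h.trans (Nat.mul_le_mul_right _ (Finset.card_le_card himg))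
    rw [Finset.card_product] at h'
    have h'' : (n * n) ^ 2 ≤ (squareSet A + squareSet A).card * (Q.card : ℝ) := by
      rw [hn_def]
      exact_mod_cast h'
    have h3 : (n * n) ^ 2 ≤ K * n * Q.card := h''.trans (by gcongr)
    refine le_of_mul_le_mul_left (a := n) ?_ hn
    linarith
  let d : F → F → F := fun x x' => (x ^ 2 - x' ^ 2) / 2
  let P : F → F → Finset F := fun x x' => x • A ∩ (x' • A + {d x x'})
  have hroots (b : F) : (A.filter fun a => a ^ 2 = b ^ 2).card ≤ 2 := by
    refine (Finset.card_le_card (t := {b, -b}) ?_).trans Finset.card_le_two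
    intro a ha
    simpa using sq_eq_sq_iff_eq_or_eq_neg.1 (Finset.mem_filter.1 ha).2
  -- `Z₁` parametrizes the solutions with `a + c = 0`, and likewise those with `b + e = 0`: in the
  -- first case `c` is determined by `a`, and `b ^ 2 = e ^ 2`.
  let Z₁ : Finset (F × F × F) := (A ×ˢ (A ×ˢ A)).filter fun p => p.2.1 ^ 2 = p.2.2 ^ 2
  have hZ₁ : Z₁.card ≤ 2 * A.card ^ 2 := by
    have : Z₁ = A ×ˢ ((A ×ˢ A).filter fun p => p.1 ^ 2 = p.2 ^ 2) := by
      ext p; simp [Z₁, and_assoc]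
    rw [this, Finset.card_product, Finset.card_filter, Finset.sum_product_right]
    have : ∑ y ∈ A, ∑ x ∈ A, (if x ^ 2 = y ^ 2 then 1 else 0) ≤ ∑ y ∈ A, 2 := by
      refine Finset.sum_le_sum fun y _ => ?_
      rw [← Finset.card_filter]
      exact hroots y
    calc A.card * _ ≤ A.card * ∑ y ∈ A, 2 := Nat.mul_le_mul_left _ this
      _ = 2 * A.card ^ 2 := by rw [Finset.sum_const, smul_eq_mul]; ring
  -- A solution with nonzero sums is determined by `x`, `x'` and the point `x * a` of `P x x'`.
  let T := (S ×ˢ S).sigma fun q => P q.1 q.2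
  have hQle : Q.card ≤ T.card + (Z₁.card + Z₁.card) := by
    have hsplit : Q ⊆ (Q.filter fun p => p.1.1 + p.2.1 ≠ 0 ∧ p.1.2 + p.2.2 ≠ 0) ∪
        ((Q.filter fun p => p.1.1 + p.2.1 = 0) ∪ (Q.filter fun p => p.1.2 + p.2.2 = 0)) := by
      intro p hp
      simp only [Finset.mem_union, Finset.mem_filter, hp, true_and]
      tauto
    refine (Finset.card_le_card hsplit).trans ((Finset.card_union_le _ _).trans ?_)
    refine Nat.add_le_add ?_ ((Finset.card_union_le _ _).trans (Nat.add_le_add ?_ ?_))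
    · refine Finset.card_le_card_of_injOn
        (fun p => ⟨(p.1.1 + p.2.1, p.1.2 + p.2.2), (p.1.1 + p.2.1) * p.1.1⟩) ?_ ?_
      · rintro ⟨⟨a, b⟩, c, e⟩ hp
        simp only [Q, Finset.coe_filter, Finset.mem_filter, Finset.mem_product,
          Set.mem_ofPred_eq] at hp
        obtain ⟨⟨⟨⟨ha, hb⟩, hc, he⟩, heq⟩, hx, hx'⟩ := hp
        simp only [T, P, d, S, Finset.coe_sigma, Set.mem_sigma_iff, Finset.mem_coe,
          Finset.mem_product, Finset.mem_erase, Finset.mem_inter]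
        refine ⟨⟨⟨hx, Finset.add_mem_add ha hc⟩, hx', Finset.add_mem_add hb he⟩,
          Finset.smul_mem_smul_finset ha, ?_⟩
        have : (a + c) * a = (b + e) • e + ((a + c) ^ 2 - (b + e) ^ 2) / 2 := by
          rw [smul_eq_mul]
          field_simp
          linear_combination heq
        rw [this]
        exact Finset.add_mem_add (Finset.smul_mem_smul_finset he) (Finset.mem_singleton_self _)
      · rintro ⟨⟨a, b⟩, c, e⟩ hp ⟨⟨a', b'⟩, c', e'⟩ hp' h
        simp only [Q, Finset.coe_filter, Finset.mem_filter, Finset.mem_product,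
          Set.mem_ofPred_eq] at hp hp'
        simp only [Sigma.mk.injEq, Prod.mk.injEq, heq_eq_eq] at h
        obtain ⟨⟨h1, h2'⟩, h3⟩ := h
        have haa : a = a' := by
          rw [← h1] at h3
          exact mul_left_cancel₀ hp.2.1 h3
        subst haa
        have hcc := add_left_cancel h1
        subst hcc
        have hbe : b = b' := by
          have e1 := hp.1.2
          have e2 := hp'.1.2
          have : 2 * (b + e) * (b - b') = 0 := by
            linear_combination e1 - e2 + (e' + e + b - b') * h2'
          have := (mul_eq_zero.1 this).resolve_left (mul_ne_zero h2 hp.2.2)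
          exact sub_eq_zero.1 this
        subst hbe
        have hee := add_left_cancel h2'
        subst hee
        rfl
    · refine Finset.card_le_card_of_injOn (fun p => (p.1.1, p.1.2, p.2.2)) ?_ ?_
      · rintro ⟨⟨a, b⟩, c, e⟩ hp
        simp only [Q, Finset.coe_filter, Finset.mem_filter, Finset.mem_product,
          Set.mem_ofPred_eq] at hp
        obtain ⟨⟨⟨⟨ha, hb⟩, hc, he⟩, heq⟩, hx⟩ := hp
        simp only [Z₁, Finset.coe_filter, Finset.mem_product, Set.mem_ofPred_eq]
        exact ⟨⟨ha, hb, he⟩, by linear_combination heq - (a - c) * hx⟩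
      · rintro ⟨⟨a, b⟩, c, e⟩ hp ⟨⟨a', b'⟩, c', e'⟩ hp' h
        simp only [Finset.coe_filter, Set.mem_ofPred_eq] at hp hp'
        simp only [Prod.mk.injEq] at h ⊢
        refine ⟨⟨h.1, h.2.1⟩, ?_, h.2.2⟩
        linear_combination hp.2 - hp'.2 - h.1
    · refine Finset.card_le_card_of_injOn (fun p => (p.1.2, p.1.1, p.2.1)) ?_ ?_
      · rintro ⟨⟨a, b⟩, c, e⟩ hp
        simp only [Q, Finset.coe_filter, Finset.mem_filter, Finset.mem_product,
          Set.mem_ofPred_eq] at hp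
        obtain ⟨⟨⟨⟨ha, hb⟩, hc, he⟩, heq⟩, hx⟩ := hp
        simp only [Z₁, Finset.coe_filter, Finset.mem_product, Set.mem_ofPred_eq]
        exact ⟨⟨hb, ha, hc⟩, by linear_combination heq - (b - e) * hx⟩
      · rintro ⟨⟨a, b⟩, c, e⟩ hp ⟨⟨a', b'⟩, c', e'⟩ hp' h
        simp only [Finset.coe_filter, Set.mem_ofPred_eq] at hp hp'
        simp only [Prod.mk.injEq] at h ⊢
        refine ⟨⟨h.2.1, h.1⟩, h.2.2, ?_⟩
        linear_combination hp.2 - hp'.2 - h.1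
  have hT : n ^ 3 ≤ 2 * K * T.card := by
    have h1 : (Q.card : ℝ) ≤ T.card + 4 * n ^ 2 := by
      have : Q.card ≤ T.card + 4 * A.card ^ 2 := by omega
      rw [hn_def]
      exact_mod_cast this
    have h3 : K * (Q.card : ℝ) ≤ K * T.card + K * (4 * n ^ 2) := by
      rw [← mul_add]
      gcongr
    have h4 : K * (4 * n ^ 2) ≤ n / 8 * (4 * n ^ 2) := by gcongr
    linarith
  have hTsum : (T.card : ℝ) = ∑ x' ∈ S, ∑ x ∈ S, ((P x x').card : ℝ) := by
    rw [Finset.card_sigma, Finset.sum_product_right]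
    push_cast
    rfl
  obtain ⟨x₀, hx₀, hx₀sum⟩ :
      ∃ x₀ ∈ S, n ^ 2 / (2 * K ^ 2) ≤ ∑ x ∈ S, ((P x x₀).card : ℝ) := by
    by_contra! hcon
    have hSne : S.Nonempty := by
      by_contra hne
      rw [Finset.not_nonempty_iff_eq_empty] at hne
      rw [hTsum, hne, Finset.sum_empty, mul_zero] at hT
      have : 0 < n ^ 3 := by positivity
      linarith
    have h := Finset.sum_lt_sum_of_nonempty hSne hcon
    rw [← hTsum, Finset.sum_const, nsmul_eq_mul] at h
    have h3 : (S.card : ℝ) * (n ^ 2 / (2 * K ^ 2)) ≤ K * n * (n ^ 2 / (2 * K ^ 2)) := by gcongr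
    have h4 : 2 * K * T.card < 2 * K * (K * n * (n ^ 2 / (2 * K ^ 2))) :=
      mul_lt_mul_of_pos_left (h.trans_le h3) (by positivity)
    have h5 : 2 * K * (K * n * (n ^ 2 / (2 * K ^ 2))) = n ^ 3 := by field_simp
    linarith
  refine ⟨x₀, Finset.ne_of_mem_erase hx₀,
    S.filter fun x => n / (4 * K ^ 3) ≤ ((P x x₀).card : ℝ), ?_, ?_, ?_⟩
  · exact (Finset.filter_subset _ _).trans (Finset.erase_subset _ _)
  · set X := S.filter fun x => n / (4 * K ^ 3) ≤ ((P x x₀).card : ℝ) with hX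
    have hbig : ∑ x ∈ X, ((P x x₀).card : ℝ) ≤ X.card * n := by
      rw [← nsmul_eq_mul]
      refine Finset.sum_le_card_nsmul _ _ _ fun x _ => ?_
      have : (P x x₀).card ≤ A.card :=
        (Finset.card_le_card Finset.inter_subset_left).trans Finset.card_image_le
      rw [hn_def]
      exact_mod_cast this
    have hsmall : ∑ x ∈ S with ¬ n / (4 * K ^ 3) ≤ ((P x x₀).card : ℝ), ((P x x₀).card : ℝ)
        ≤ n ^ 2 / (4 * K ^ 2) :=
      calc _ ≤ ∑ x ∈ S with ¬ n / (4 * K ^ 3) ≤ ((P x x₀).card : ℝ), n / (4 * K ^ 3) :=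
            Finset.sum_le_sum fun x hx => (not_le.1 (Finset.mem_filter.1 hx).2).le
        _ ≤ ∑ x ∈ S, n / (4 * K ^ 3) :=
            Finset.sum_le_sum_of_subset_of_nonneg (Finset.filter_subset _ _)
              fun _ _ _ => by positivity
        _ = S.card * (n / (4 * K ^ 3)) := by rw [Finset.sum_const, nsmul_eq_mul]
        _ ≤ K * n * (n / (4 * K ^ 3)) := by gcongr
        _ = n ^ 2 / (4 * K ^ 2) := by field_simp
    have hsum := Finset.sum_filter_add_sum_filter_not S
      (fun x => n / (4 * K ^ 3) ≤ ((P x x₀).card : ℝ)) fun x => ((P x x₀).card : ℝ)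
    refine le_of_mul_le_mul_right (a := n) ?_ hn
    have e1 : n ^ 2 / (2 * K ^ 2) = 2 * (n ^ 2 / (4 * K ^ 2)) := by field_simp; norm_num
    have e2 : n / (4 * K ^ 2) * n = n ^ 2 / (4 * K ^ 2) := by ring
    linarith
  · exact fun x hx => ⟨d x x₀, (Finset.mem_filter.1 hx).2⟩

/-! ### The sum–sum-of-squares estimate -/

theorem theorem1p2 :
    ∃ C : ℝ, 0 < C ∧
      ∀ (F : Type*) [Field F] [Finite F] [DecidableEq F] (A : Finset F),
        (∀ (G : Subfield F) (a b : F), a ≠ 0 →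
          ((((A + A : Finset F) : Set F) ∩ (a • (G : Set F) + {b})).ncard : ℝ)
            ≤ (Nat.card G : ℝ) ^ (1 / 2 : ℝ)) →
        C * (A.card : ℝ) ^ (1 + 1 / 42 : ℝ)
          ≤ max ((A + A).card : ℝ) ((squareSet A + squareSet A).card : ℝ) := by
  refine ⟨1 / 2, by norm_num, fun F _ _ _ A hA => ?_⟩
  obtain rfl | hne := A.eq_empty_or_nonempty
  · rw [Finset.card_empty, Nat.cast_zero, Real.zero_rpow (by norm_num), mul_zero]
    exact le_max_of_le_left (Nat.cast_nonneg _)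
  set M : ℝ := max ((A + A).card : ℝ) ((squareSet A + squareSet A).card : ℝ) with hM
  set n : ℝ := (A.card : ℝ) with hn_def
  have hn1 : 1 ≤ n := Nat.one_le_cast.2 hne.card_pos
  have hn : 0 < n := by linarith
  have hnM : n ≤ M :=
    (Nat.cast_le.2 (Finset.card_le_card_add_right hne)).trans (le_max_left _ _)
  set K : ℝ := M / n with hK_def
  have hK1 : 1 ≤ K := (one_le_div hn).2 hnM
  have hKn : K * n = M := div_mul_cancel₀ M hn.ne'
  suffices h : n ≤ 2 ^ 15 * K ^ 36 by
    -- The constants leave room: `2 ^ 15 ≤ 2 ^ 42` and `K ^ 36 ≤ K ^ 42`.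
    have h42 : n ≤ (2 * K) ^ 42 := by
      rw [mul_pow]
      refine h.trans ?_
      gcongr <;> norm_num [hK1]
    have hroot : n ^ (1 / 42 : ℝ) ≤ 2 * K := by
      calc n ^ (1 / 42 : ℝ) ≤ ((2 * K) ^ 42) ^ (1 / 42 : ℝ) := by gcongr
        _ = 2 * K := by
          rw [← Real.rpow_natCast, ← Real.rpow_mul (by positivity)]
          norm_num
    rw [Real.rpow_add hn, Real.rpow_one, ← hKn]
    calc 1 / 2 * (n * n ^ (1 / 42 : ℝ)) ≤ 1 / 2 * (n * (2 * K)) := by gcongr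
      _ = K * n := by ring
  have htriv {i : ℕ} (hi : i ≤ 36) {C : ℝ} (hC0 : 0 ≤ C) (hC : C ≤ 2 ^ 15) (h : n ≤ C * K ^ i) :
      n ≤ 2 ^ 15 * K ^ 36 :=
    h.trans (mul_le_mul hC (pow_le_pow_right₀ hK1 hi) (by positivity) (by positivity))
  have hsub (G : Subfield F) (X : Finset F) (hXA : X ⊆ A + A) (a b : F) (ha : a ≠ 0)
      (hX : (X : Set F) ⊆ a • (G : Set F) + {b}) : X.card ^ 2 ≤ Nat.card G := by
    have h1 : (X.card : ℝ) ≤ (Nat.card G : ℝ) ^ (1 / 2 : ℝ) := by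
      refine le_trans ?_ (hA G a b ha)
      rw [← Set.ncard_coe_finset]
      exact_mod_cast Set.ncard_le_ncard (Set.subset_inter (Finset.coe_subset.2 hXA) hX)
        (Set.toFinite _)
    have h2 : (X.card : ℝ) ^ 2 ≤ ((Nat.card G : ℝ) ^ (1 / 2 : ℝ)) ^ 2 := by gcongr
    rw [← Real.sqrt_eq_rpow, Real.sq_sqrt (Nat.cast_nonneg _)] at h2
    exact_mod_cast h2
  by_cases h2 : (2 : F) = 0
  · have hle : A.card ≤ 1 := by
      refine (Finset.card_le_card_add_right hne).trans (Finset.card_le_one.2 ?_)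
      intro x hx y hy
      by_contra hxy
      -- Two points `x ≠ y` form a translated dilate of the prime field, so `4 ≤ 2`.
      have : CharP F 2 := CharTwo.of_one_ne_zero_of_two_eq_zero one_ne_zero h2
      have hb := hsub ⊥ {x, y} (by simp [Finset.insert_subset_iff, hx, hy]) (y - x) x
        (sub_ne_zero.2 (Ne.symm hxy)) (by
          rw [Finset.coe_pair, Set.pair_subset_iff]
          exact ⟨⟨_, ⟨0, zero_mem _, rfl⟩, x, rfl, by simp⟩,
            ⟨_, ⟨1, one_mem _, rfl⟩, x, rfl, by simp⟩⟩)
      rw [Subfield.card_bot F 2, Finset.card_pair hxy] at hb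
      norm_num at hb
    refine htriv (i := 0) (C := 1) (by norm_num) (by norm_num) (by norm_num) ?_
    rw [pow_zero, mul_one, hn_def]
    exact_mod_cast hle
  by_cases hK8 : K ≤ n / 8
  swap
  · refine htriv (i := 1) (C := 8) (by norm_num) (by norm_num) (by norm_num) ?_
    linarith
  have hKA : ((A + A).card : ℝ) ≤ K * A.card := (le_max_left _ _).trans hKn.ge
  obtain ⟨x₀, hx₀, X, hXA, hXcard, hN⟩ := exists_popular_dilates h2 hne (by linarith) hK8 hKA
    ((le_max_right _ _).trans hKn.ge)
  by_cases hX2 : 2 ≤ X.card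
  · refine card_le_mul_pow_of_popular_dilates hne hK1 hKA hx₀ hXA hX2 hXcard hN ?_
    intro G hXG
    refine hsub G X hXA x₀ 0 hx₀ ?_
    rwa [Set.singleton_zero, add_zero]
  · refine htriv (i := 2) (C := 4) (by norm_num) (by norm_num) (by norm_num) ?_
    have h1 : (X.card : ℝ) ≤ 1 := by exact_mod_cast (by omega : X.card ≤ 1)
    have h3 := hXcard.trans h1
    rwa [div_le_one (by positivity)] at h3
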